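/- Let $G$ be a finitely generated infinite group and $S\subset G$ a finite symmetric generating set not containing the identity $e$. Let $\Gamma=\mathrm{Cay}(G,S)$ be the Cayley graph: its vertex set is $G$, and $i\sim j$ if and only if $j=is$ for some $s\in S$. Let $V(n)$ be the number of vertices at graph distance at most $n$ from $e$. Suppose that $\Gamma$ has polynomial growth of order $d$ for an integer $d\ge 2$, i.e. there is $C\ge 1$ such that $C^{-1}n^d\le V(n)\le Cn^d$ for all integers $n\ge 1$. For a finite connected subset $\Omega\subset G$, let $B=\{j\in G\setminus\Omega : j\sim i \text{ for some } i\in\Omega\}$, let $\bar\Omega=\Omega\cup B$, and endow $\bar\Omega$ with the edge set $E'$ of all edges $\{i,j\}$ of $\Gamma$ with $i\in\Omega$ and $j\in\bar\Omega$. This finite graph with boundary $B$ is called the subgraph $(\Omega,B)$ of $\Gamma$. A real number $\sigma$ is a Steklov eigenvalue of $(\Omega,B)$ if there is a nonzero function $u:\bar\Omega\to\mathbb R$ such that $$\sum_{j:\{i,j\}\in E'}(u(i)-u(j))=\begin{cases}0 & \text{if } i\in\Omega,\\ \sigma\,u(i) & \text{if } i\in B.\end{cases}$$ Counted with multiplicity,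 the Steklov eigenvalues form a sequence $0=\sigma_0(\Omega,B)\le\sigma_1(\Omega,B)\le\dots\le\sigma_{|B|-1}(\Omega,B)$. Let $(\Omega_l,B_l)_{l\ge 1}$ be a sequence of subgraphs of $\Gamma$ such that $|\Omega_l|\to\infty$ as $l\to\infty$, and fix an integer $k\ge 0$. Then $k<|B_l|$ for all sufficiently large $l$ (so that $\sigma_k(\Omega_l,B_l)$ is defined), and $$\sigma_k(\Omega_l,B_l)\longrightarrow 0\qquad\text{as } l\to\infty .$$ -/

import Mathlib

namespace Steklov

/-! ### Finite graphs with boundary and their Steklov spectrum -/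

section Spectrum

variable {V : Type*} [Fintype V]

open Classical in
/-- The Laplacian `(Δ u) i = ∑_{j ∼ i} (u i - u j)` of a finite graph. -/
noncomputable def laplacian (Γ : SimpleGraph V) : (V → ℝ) →ₗ[ℝ] (V → ℝ) where
  toFun u i := ∑ j with Γ.Adj i j, (u i - u j)
  map_add' u v := by
    funext i
    simp only [Pi.add_apply, ← Finset.sum_add_distrib]
    exact Finset.sum_congr rfl fun j _ => by ring
  map_smul' c u := by
    funext i
    simp only [Pi.smul_apply, smul_eq_mul, RingHom.id_apply, Finset.mul_sum]
    exact Finset.sum_congr rfl fun j _ => by ring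

/-- The normal derivative `(∂u/∂ν) i = ∑_{j ∼ i} (u i - u j)` for `i` in the boundary `B`;
it is the restriction of the Laplacian to `B`. -/
noncomputable def normalDerivative (Γ : SimpleGraph V) (B : Set V) : (V → ℝ) →ₗ[ℝ] (B → ℝ) :=
  (LinearMap.funLeft ℝ ℝ (Subtype.val : B → V)).comp (laplacian Γ)

/-- The space of solutions `u` of the Steklov problem with parameter `σ` on the graph with
boundary `(Γ, B)`: `Δ u = 0` off `B` and `∂u/∂ν = σ u` on `B`. The number `σ` is a Steklov
eigenvalue exactly when this space is nonzero, and its dimension is the multiplicity of `σ`. -/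
noncomputable def steklovEigenspace (Γ : SimpleGraph V) (B : Set V) (σ : ℝ) :
    Submodule ℝ (V → ℝ) where
  carrier := {u | (∀ i ∉ B, laplacian Γ u i = 0) ∧
    ∀ i : B, normalDerivative Γ B u i = σ * u i}
  zero_mem' := by simp
  add_mem' := by
    rintro u v ⟨hu, hu'⟩ ⟨hv, hv'⟩
    refine ⟨fun i hi => by simp [hu i hi, hv i hi], fun i => ?_⟩
    simp only [map_add, Pi.add_apply, hu' i, hv' i, mul_add]
  smul_mem' := by
    rintro c u ⟨hu, hu'⟩
    refine ⟨fun i hi => by simp [hu i hi], fun i => ?_⟩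
    simp only [map_smul, Pi.smul_apply, smul_eq_mul, hu' i]
    ring

/-- The number of Steklov eigenvalues `t ≤ s` of `(Γ, B)`, counted with multiplicity: the
dimension of the sum of the corresponding eigenspaces. -/
noncomputable def steklovCount (Γ : SimpleGraph V) (B : Set V) (s : ℝ) : ℕ :=
  Module.finrank ℝ (⨆ t : Set.Iic s, steklovEigenspace Γ B t : Submodule ℝ (V → ℝ))

/-- The Steklov eigenvalue `σ_k`, where `σ_0 ≤ σ_1 ≤ ⋯ ≤ σ_{|B|-1}` lists the Steklov
eigenvalues of `(Γ, B)`, repeated according to multiplicity: the least `s` such that at least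
`k + 1` eigenvalues, counted with multiplicity, are `≤ s`. It is meaningful for `k < |B|`. -/
noncomputable def steklovEigenvalue (Γ : SimpleGraph V) (B : Set V) (k : ℕ) : ℝ :=
  sInf {s : ℝ | k + 1 ≤ steklovCount Γ B s}

end Spectrum

/-! ### Subgraphs `(Ω, B)` of a graph -/

section Subgraph

variable {V : Type*}

/-- The boundary `B` of `Ω`: the vertices outside `Ω` that are adjacent to a vertex of `Ω`. -/
def vertexBoundary (Γ : SimpleGraph V) (Ω : Set V) : Set V :=
  {j | j ∉ Ω ∧ ∃ i ∈ Ω, Γ.Adj i j}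

/-- `Ω̄ = Ω ∪ B`. -/
def vertexClosure (Γ : SimpleGraph V) (Ω : Set V) : Set V :=
  Ω ∪ vertexBoundary Γ Ω

/-- The graph `(Ω̄, E')`, whose edges are the edges of `Γ` between a vertex of `Ω` and a vertex
of `Ω̄` (edges of `Γ` joining two vertices of `B` are left out). -/
def closureGraph (Γ : SimpleGraph V) (Ω : Set V) : SimpleGraph (vertexClosure Γ Ω) where
  Adj i j := Γ.Adj i j ∧ ((i : V) ∈ Ω ∨ (j : V) ∈ Ω)
  symm := ⟨fun _ _ h => ⟨h.1.symm, h.2.symm⟩⟩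
  loopless := ⟨fun _ h => Γ.loopless.irrefl _ h.1⟩

/-- The boundary `B`, as a set of vertices of `(Ω̄, E')`. -/
def closureBoundary (Γ : SimpleGraph V) (Ω : Set V) : Set (vertexClosure Γ Ω) :=
  {i | (i : V) ∈ vertexBoundary Γ Ω}

end Subgraph

/-! ### Cayley graphs and polynomial growth -/

section Cayley

variable {G : Type*} [Group G]

/-- The Cayley graph `Cay(G, S)`: for `S` symmetric with `1 ∉ S`, the vertices `i`, `j` are
adjacent if and only if `j = i * s` for some `s ∈ S`. -/
abbrev cayleyGraph (S : Finset G) : SimpleGraph G :=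
  SimpleGraph.mulCayley (S : Set G)

/-- In a Cayley graph, `Ω̄` is finite if `Ω` is. -/
theorem finite_vertexClosure (S Ω : Finset G) :
    (vertexClosure (cayleyGraph S) (Ω : Set G)).Finite := by
  classical
  refine Ω.finite_toSet.union
    (((Ω ×ˢ S).image (fun p => p.1 * p.2) ∪
      (Ω ×ˢ S).image (fun p => p.1 * p.2⁻¹)).finite_toSet.subset ?_)
  rintro j ⟨-, i, hi, hij⟩
  rw [SimpleGraph.mulCayley_adj] at hij
  simp only [Finset.coe_union, Finset.coe_image, Set.mem_union, Set.mem_image, Finset.mem_coe,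
    Finset.mem_product, Prod.exists]
  rcases hij.2 with h | h
  · exact Or.inl ⟨i, _, ⟨hi, h⟩, by group⟩
  · exact Or.inr ⟨i, _, ⟨hi, h⟩, by group⟩

noncomputable instance instFintypeVertexClosure (S Ω : Finset G) :
    Fintype (vertexClosure (cayleyGraph S) (Ω : Set G)) :=
  (finite_vertexClosure S Ω).fintype

/-- The growth function `V(n)`: the number of vertices at distance at most `n` from the identity
in `Cay(G, S)`. -/
noncomputable def growthFunction (S : Finset G) (n : ℕ) : ℕ :=
  {g : G | (cayleyGraph S).edist 1 g ≤ n}.ncard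

/-- `Cay(G, S)` has polynomial growth of order `d`: `C⁻¹ n ^ d ≤ V(n) ≤ C n ^ d` for all
`n ≥ 1`. (At `n = 0` the upper bound fails for every `d ≥ 1`, since `V(0) = 1`.) -/
def HasPolynomialGrowth (S : Finset G) (d : ℕ) : Prop :=
  ∃ C : ℝ, 1 ≤ C ∧ ∀ n : ℕ, 1 ≤ n →
    C⁻¹ * (n : ℝ) ^ d ≤ growthFunction S n ∧ (growthFunction S n : ℝ) ≤ C * (n : ℝ) ^ d

/-- The Steklov eigenvalue `σ_k(Ω, B)` of the subgraph `(Ω, B)` of `Cay(G, S)`. -/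
noncomputable def subgraphSteklovEigenvalue (S Ω : Finset G) (k : ℕ) : ℝ :=
  steklovEigenvalue (closureGraph (cayleyGraph S) (Ω : Set G))
    (closureBoundary (cayleyGraph S) (Ω : Set G)) k

end Cayley

end Steklov

/-!
The eigenvalue `σ_k` is bounded by the min-max principle: it is at most `s` as soon as there are
`k + 1` test functions on `Ω ∪ B`, orthogonal for the Dirichlet form and on the boundary, whose
Rayleigh quotients `D(f, f) / ∑_{b ∈ B} f b ^ 2` are at most `s` (`steklovEigenvalue_mem_Icc`). Its
proof diagonalizes the Dirichlet-to-Neumann operator, using that harmonic extensions exist and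
minimize the energy.

The test functions are tents `y ↦ max (2 r - d(x, y)) 0`. Let `N` be the least radius for which a
ball has at least `2 |Ω|` points, so that `|Ω|` is comparable to `N ^ d`, and let `r` be a small
fixed multiple of `N`.

* *The boundary is spread out at scale `r`.* By the isoperimetric inequality of Coulhon and
  Saloff-Coste (`card_le_two_mul_mul_card_boundary`), every subset of `Ω` of at least half its size
  has at least `|Ω| / (4 N)` boundary points. Apply this to `Ω` minus `k` balls of a common radius
  in `(5 r, 10 r]`, chosen such that the spheres are no larger than average. The spheres have about
  `r ^ (d - 1)` points, few compared to `|Ω| / N ≈ N ^ (d - 1)` since `d ≥ 2` and `r / N` is small.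
  Hence at least `|Ω| / (8 N)` points of `B` lie outside any `k` balls of radius `5 r`
  (`card_le_card_boundary_far`).
* *Averaging.* Summing over all centres near these boundary points, the tents have total mass at
  least `r ^ 2 * vol r * |Ω| / (8 N)` on `B` and total energy at most `2 * vol (2 r) * |S| * |Ω|`.
  By volume doubling, some tent has Rayleigh quotient `O(N / r ^ 2) = O(1 / r)` (`exists_tent`).
* *Iteration.* The centre found is at distance at least `4 r` from the centres of the removed
  balls, so repeating this gives `k + 1` tents whose supports are disjoint and not joined by edges
  (`exists_separated_tents`). As `|Ω| → ∞`, also `r → ∞`, and `σ_k = O(1 / r)` tends to `0`.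
-/

namespace Steklov

open Finset

/-! ### The Dirichlet form -/

section Dirichlet

variable {V : Type*} [Fintype V]

/-- The Dirichlet form `D(u, v) = ∑_i (Δ u) i * v i` of a finite graph. By the discrete Green
formula `dirichletForm_eq`, it is also the sum of `(u i - u j) * (v i - v j)` over the edges. -/
noncomputable def dirichletForm (Γ : SimpleGraph V) (u v : V → ℝ) : ℝ :=
  ∑ i, laplacian Γ u i * v i

open Classical in
theorem dirichletForm_eq (Γ : SimpleGraph V) (u v : V → ℝ) :
    dirichletForm Γ u v = (∑ i, ∑ j with Γ.Adj i j, (u i - u j) * (v i - v j)) / 2 := by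
  have h1 : dirichletForm Γ u v = ∑ i, ∑ j with Γ.Adj i j, (u i - u j) * v i :=
    sum_congr rfl fun i _ => by simp only [laplacian, LinearMap.coe_mk, AddHom.coe_mk, sum_mul]
  have h2 : dirichletForm Γ u v = ∑ i, ∑ j with Γ.Adj i j, (u j - u i) * v j := by
    rw [h1]
    simp only [sum_filter]
    rw [sum_comm]
    simp only [Γ.adj_comm]
  have h3 : ∑ i, ∑ j with Γ.Adj i j, (u i - u j) * (v i - v j) =
      dirichletForm Γ u v + dirichletForm Γ u v := by
    nth_rw 1 [h1]
    rw [h2, ← sum_add_distrib]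
    refine sum_congr rfl fun i _ => ?_
    rw [← sum_add_distrib]
    exact sum_congr rfl fun j _ => by ring
  rw [h3]; ring

theorem dirichletForm_comm (Γ : SimpleGraph V) (u v : V → ℝ) :
    dirichletForm Γ u v = dirichletForm Γ v u := by
  classical
  rw [dirichletForm_eq, dirichletForm_eq]
  simp only [mul_comm]

theorem dirichletForm_self_nonneg (Γ : SimpleGraph V) (u : V → ℝ) :
    0 ≤ dirichletForm Γ u u := by
  classical
  rw [dirichletForm_eq]
  exact div_nonneg (sum_nonneg fun i _ => sum_nonneg fun j _ => mul_self_nonneg _) (by norm_num)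

theorem dirichletForm_add_left (Γ : SimpleGraph V) (u v w : V → ℝ) :
    dirichletForm Γ (u + v) w = dirichletForm Γ u w + dirichletForm Γ v w := by
  simp only [dirichletForm, map_add, Pi.add_apply, add_mul, sum_add_distrib]

theorem dirichletForm_smul_left (Γ : SimpleGraph V) (c : ℝ) (u w : V → ℝ) :
    dirichletForm Γ (c • u) w = c * dirichletForm Γ u w := by
  simp only [dirichletForm, map_smul, Pi.smul_apply, smul_eq_mul, mul_sum, mul_assoc]

theorem dirichletForm_sum_left {ι : Type*} (Γ : SimpleGraph V) (s : Finset ι) (f : ι → V → ℝ)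
    (w : V → ℝ) :
    dirichletForm Γ (∑ a ∈ s, f a) w = ∑ a ∈ s, dirichletForm Γ (f a) w := by
  simp only [dirichletForm, map_sum, Finset.sum_apply, sum_mul]
  exact sum_comm

/-- A function of vanishing Dirichlet energy is constant along edges. -/
theorem eq_of_adj_of_dirichletForm_eq_zero {Γ : SimpleGraph V} {u : V → ℝ}
    (h : dirichletForm Γ u u = 0) {i j : V} (hij : Γ.Adj i j) : u i = u j := by
  classical
  rw [dirichletForm_eq, div_eq_zero_iff, or_iff_left (by norm_num),
    sum_eq_zero_iff_of_nonneg fun i _ => sum_nonneg fun j _ => mul_self_nonneg _] at h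
  have h' := h i (mem_univ i)
  rw [sum_eq_zero_iff_of_nonneg fun j _ => mul_self_nonneg _] at h'
  exact sub_eq_zero.1 (mul_self_eq_zero.1 (h' j (by simpa using hij)))

end Dirichlet

/-! ### The variational principle for the Steklov spectrum -/

section MinMax

variable {V : Type*} [Fintype V]

open Classical in
/-- Pairing the Laplacian with a test function reduces to the boundary when the Laplacian
vanishes off the boundary. -/
theorem dirichletForm_eq_sum_boundary {Γ : SimpleGraph V} {B : Set V} {u : V → ℝ}
    (hu : ∀ i ∉ B, laplacian Γ u i = 0) (v : V → ℝ) :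
    dirichletForm Γ u v = ∑ b : B, laplacian Γ u b * v b := by
  rw [dirichletForm, ← Finset.sum_subtype (univ.filter (· ∈ B)) (by simp)
    (fun i => laplacian Γ u i * v i), sum_filter]
  refine sum_congr rfl fun i _ => ?_
  split_ifs with h
  · rfl
  · rw [hu i h, zero_mul]

/-- If a function of zero energy that vanishes on the boundary is zero, then boundary data have
harmonic extensions, depending linearly on the data. -/
theorem exists_harmonic_extension {Γ : SimpleGraph V} {B : Set V}
    (huniq : ∀ u : V → ℝ, dirichletForm Γ u u = 0 → (∀ b ∈ B, u b = 0) → u = 0) :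
    ∃ ext : (B → ℝ) →ₗ[ℝ] (V → ℝ), (∀ φ (b : B), ext φ b = φ b) ∧
      ∀ φ, ∀ i ∉ B, laplacian Γ (ext φ) i = 0 := by
  classical
  -- the map sending `u` to its boundary values on `B` and to its Laplacian off `B` is injective,
  -- hence bijective
  let L : (V → ℝ) →ₗ[ℝ] (V → ℝ) := LinearMap.pi fun i =>
    if i ∈ B then LinearMap.proj i else (LinearMap.proj i).comp (laplacian Γ)
  have hL : ∀ u i, L u i = if i ∈ B then u i else laplacian Γ u i := by
    intro u i
    simp only [L, LinearMap.pi_apply]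
    split_ifs <;> rfl
  have hinj : Function.Injective L := by
    rw [← LinearMap.ker_eq_bot, LinearMap.ker_eq_bot']
    intro u hu
    have hB : ∀ b ∈ B, u b = 0 := fun b hb => by
      have := congrFun hu b
      rwa [hL, if_pos hb] at this
    refine huniq u (sum_eq_zero fun i _ => ?_) hB
    by_cases hi : i ∈ B
    · rw [hB i hi, mul_zero]
    · have := congrFun hu i
      rw [hL, if_neg hi] at this
      rw [this, Pi.zero_apply, zero_mul]
  let e := LinearEquiv.ofInjectiveEndo L hinj
  let z : (B → ℝ) →ₗ[ℝ] (V → ℝ) := LinearMap.pi fun i =>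
    if h : i ∈ B then LinearMap.proj (⟨i, h⟩ : B) else 0
  have key : ∀ φ, L (e.symm (z φ)) = z φ := fun φ => e.apply_symm_apply (z φ)
  refine ⟨e.symm.toLinearMap.comp z, fun φ b => ?_, fun φ i hi => ?_⟩
  · have := congrFun (key φ) b
    rw [hL, if_pos b.2] at this
    simp only [LinearMap.comp_apply, LinearEquiv.coe_coe, this]
    simp [z]
  · have := congrFun (key φ) i
    rw [hL, if_neg hi] at this
    simp only [LinearMap.comp_apply, LinearEquiv.coe_coe, this]
    simp [z, hi]

open Classical in
/-- One half of the min-max principle: the Steklov eigenvalues `≤ s` are at least as many as the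
dimension of any space of functions on which the Rayleigh quotient is at most `s`. The proof
diagonalizes the Dirichlet-to-Neumann operator. -/
theorem finrank_le_steklovCount {Γ : SimpleGraph V} {B : Set V}
    (huniq : ∀ u : V → ℝ, dirichletForm Γ u u = 0 → (∀ b ∈ B, u b = 0) → u = 0)
    (s : ℝ) (W : Submodule ℝ (V → ℝ))
    (hpos : ∀ u ∈ W, u ≠ 0 → 0 < ∑ b : B, u b ^ 2)
    (hW : ∀ u ∈ W, dirichletForm Γ u u ≤ s * ∑ b : B, u b ^ 2) :
    Module.finrank ℝ W ≤ steklovCount Γ B s := by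
  obtain ⟨ext, hext, hharm⟩ := exists_harmonic_extension huniq
  let T : EuclideanSpace ℝ B →ₗ[ℝ] EuclideanSpace ℝ B :=
    (WithLp.linearEquiv 2 ℝ (B → ℝ)).symm.toLinearMap.comp
      ((normalDerivative Γ B).comp (ext.comp (WithLp.linearEquiv 2 ℝ (B → ℝ)).toLinearMap))
  have hT_apply : ∀ φ (b : B), T φ b = laplacian Γ (ext φ.ofLp) b := fun φ b => rfl
  have hT_inner : ∀ φ ψ, inner ℝ (T φ) ψ = dirichletForm Γ (ext φ.ofLp) (ext ψ.ofLp) := by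
    intro φ ψ
    rw [dirichletForm_eq_sum_boundary (hharm _), PiLp.inner_apply]
    refine sum_congr rfl fun b _ => ?_
    rw [hT_apply, hext]
    simp [mul_comm]
  have hT : T.IsSymmetric := fun φ ψ => by
    rw [hT_inner, real_inner_comm, hT_inner, dirichletForm_comm]
  let e := hT.eigenvectorBasis rfl
  let μ := hT.eigenvalues rfl
  have he : ∀ i, T (e i) = μ i • e i := fun i => hT.apply_eigenvectorBasis rfl i
  -- the eigenvectors with eigenvalue at most `s` extend to independent Steklov eigenfunctions
  let I := {i // μ i ≤ s}
  have hmem : ∀ i : I, ext (e i).ofLp ∈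
      (⨆ t : Set.Iic s, steklovEigenspace Γ B t : Submodule ℝ (V → ℝ)) := by
    intro i
    refine Submodule.mem_iSup_of_mem (⟨μ i, i.2⟩ : Set.Iic s) ⟨hharm _, fun b => ?_⟩
    have := congrArg (fun φ : EuclideanSpace ℝ B => φ b) (he i)
    simp only [hT_apply] at this
    rw [hext]
    exact this
  have hli : LinearIndependent ℝ (fun i : I => ext (e i).ofLp) := by
    have h1 : LinearIndependent ℝ (fun i : I => e i) :=
      e.orthonormal.linearIndependent.comp _ Subtype.val_injective
    have hker : LinearMap.ker
        (ext.comp (WithLp.linearEquiv 2 ℝ (B → ℝ)).toLinearMap) = ⊥ := by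
      rw [LinearMap.ker_eq_bot']
      intro φ hφ
      ext b
      have := congrFun hφ b
      rwa [LinearMap.comp_apply, hext] at this
    exact h1.map' _ hker
  have hI : Fintype.card I ≤ steklovCount Γ B s := by
    rw [← finrank_span_eq_card hli]
    refine Submodule.finrank_mono (Submodule.span_le.2 ?_)
    rintro _ ⟨i, rfl⟩
    exact hmem i
  refine le_trans ?_ hI
  by_contra! hlt
  -- a nonzero `u ∈ W` whose boundary values are orthogonal to those eigenvectors
  let res : (V → ℝ) →ₗ[ℝ] EuclideanSpace ℝ B :=
    (WithLp.linearEquiv 2 ℝ (B → ℝ)).symm.toLinearMap.comp (LinearMap.funLeft ℝ ℝ Subtype.val)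
  have hres : ∀ u (b : B), res u b = u b := fun u b => rfl
  let Φ : W →ₗ[ℝ] (I → ℝ) := LinearMap.pi fun i =>
    (innerₛₗ ℝ (e i)).comp (res.comp W.subtype)
  have hΦ : LinearMap.ker Φ ≠ ⊥ := LinearMap.ker_ne_bot_of_finrank_lt (by simpa using hlt)
  obtain ⟨⟨u, huW⟩, huk, hu0⟩ := Submodule.exists_mem_ne_zero_of_ne_bot hΦ
  have hu0' : u ≠ 0 := fun h => hu0 (Subtype.ext h)
  have horth : ∀ i, μ i ≤ s → inner ℝ (e i) (res u) = 0 := fun i hi =>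
    congrFun (LinearMap.mem_ker.1 huk) ⟨i, hi⟩
  have hnorm : ∑ b : B, u b ^ 2 = ∑ i, inner ℝ (e i) (res u) ^ 2 := by
    have h1 := e.sum_sq_norm_inner_right (res u)
    rw [EuclideanSpace.norm_sq_eq] at h1
    simp only [Real.norm_eq_abs, sq_abs, hres] at h1
    exact h1.symm
  have hTu : inner ℝ (T (res u)) (res u) = ∑ i, μ i * inner ℝ (e i) (res u) ^ 2 := by
    rw [← e.sum_inner_mul_inner]
    refine sum_congr rfl fun i _ => ?_
    rw [hT, he, inner_smul_right, real_inner_comm]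
    ring
  have hlt' : s * ∑ b : B, u b ^ 2 < inner ℝ (T (res u)) (res u) := by
    have hp := hpos u huW hu0'
    rw [hnorm] at hp
    obtain ⟨i, -, hi⟩ := exists_ne_zero_of_sum_ne_zero hp.ne'
    rw [hnorm, hTu, mul_sum]
    refine sum_lt_sum (fun i _ => ?_) ⟨i, mem_univ i, ?_⟩
    · rcases le_or_gt (μ i) s with h | h
      · rw [horth i h]; simp
      · exact mul_le_mul_of_nonneg_right h.le (sq_nonneg _)
    · have hμ : s < μ i := by
        by_contra! h
        exact hi (by rw [horth i h]; simp)
      exact mul_lt_mul_of_pos_right hμ (lt_of_le_of_ne (sq_nonneg _) (Ne.symm hi))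
  -- the harmonic extension minimizes the energy among extensions of the boundary values
  set h := ext (res u).ofLp
  have hw : ∀ b : B, (u - h) b = 0 := fun b => by
    rw [Pi.sub_apply, sub_eq_zero]
    exact (hext (res u).ofLp b).symm
  have hcross : dirichletForm Γ h (u - h) = 0 := by
    rw [dirichletForm_eq_sum_boundary (hharm _)]
    exact sum_eq_zero fun b _ => by rw [hw, mul_zero]
  have hmin : dirichletForm Γ h h ≤ dirichletForm Γ u u := by
    have h1 : dirichletForm Γ u u = dirichletForm Γ h h + 2 * dirichletForm Γ h (u - h) +
        dirichletForm Γ (u - h) (u - h) := by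
      conv_lhs => rw [show u = h + (u - h) by abel]
      rw [dirichletForm_add_left, dirichletForm_comm Γ h, dirichletForm_comm Γ (u - h) (h + _),
        dirichletForm_add_left, dirichletForm_add_left, dirichletForm_comm Γ (u - h) h]
      ring
    rw [h1, hcross]
    linarith [dirichletForm_self_nonneg Γ (u - h)]
  rw [hT_inner] at hlt'
  linarith [hW u huW]

/-- Steklov eigenvalues are nonnegative. -/
theorem steklovCount_eq_zero_of_neg {Γ : SimpleGraph V} {B : Set V}
    (huniq : ∀ u : V → ℝ, dirichletForm Γ u u = 0 → (∀ b ∈ B, u b = 0) → u = 0)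
    {s : ℝ} (hs : s < 0) : steklovCount Γ B s = 0 := by
  classical
  have : (⨆ t : Set.Iic s, steklovEigenspace Γ B t : Submodule ℝ (V → ℝ)) = ⊥ := by
    rw [eq_bot_iff]
    refine iSup_le ?_
    rintro ⟨t, ht⟩ u ⟨hu, hu'⟩
    have ht0 : t < 0 := lt_of_le_of_lt ht hs
    have h1 : dirichletForm Γ u u = t * ∑ b : B, u b ^ 2 := by
      rw [dirichletForm_eq_sum_boundary hu, mul_sum]
      refine sum_congr rfl fun b _ => ?_
      rw [show laplacian Γ u b = t * u b from hu' b]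
      ring
    have h2 := dirichletForm_self_nonneg Γ u
    have h3 : 0 ≤ ∑ b : B, u b ^ 2 := sum_nonneg fun b _ => sq_nonneg _
    have h4 : ∑ b : B, u b ^ 2 = 0 := by nlinarith
    refine huniq u (by rw [h1, h4, mul_zero]) fun b hb => ?_
    rw [sum_eq_zero_iff_of_nonneg fun b _ => sq_nonneg _] at h4
    exact pow_eq_zero_iff two_ne_zero |>.1 (h4 ⟨b, hb⟩ (mem_univ _))
  rw [steklovCount, this, finrank_bot]

open Classical in
/-- Test functions that are orthogonal both for the Dirichlet form and on the boundary, with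
Rayleigh quotients at most `s`, bound the Steklov eigenvalues from above. -/
theorem steklovEigenvalue_mem_Icc {Γ : SimpleGraph V} {B : Set V}
    (huniq : ∀ u : V → ℝ, dirichletForm Γ u u = 0 → (∀ b ∈ B, u b = 0) → u = 0)
    {s : ℝ} {k : ℕ} (F : Fin (k + 1) → V → ℝ)
    (hpos : ∀ a, 0 < ∑ b : B, F a b ^ 2)
    (hF : ∀ a, dirichletForm Γ (F a) (F a) ≤ s * ∑ b : B, F a b ^ 2)
    (hFD : ∀ a a', a ≠ a' → dirichletForm Γ (F a) (F a') = 0)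
    (hFB : ∀ a a', a ≠ a' → ∀ b ∈ B, F a b * F a' b = 0) :
    steklovEigenvalue Γ B k ∈ Set.Icc 0 s := by
  have hmass : ∀ c : Fin (k + 1) → ℝ,
      ∑ b : B, (∑ a, c a • F a) b ^ 2 = ∑ a, c a ^ 2 * ∑ b : B, F a b ^ 2 := by
    intro c
    simp only [mul_sum]
    rw [sum_comm]
    refine sum_congr rfl fun b _ => ?_
    simp only [Finset.sum_apply, Pi.smul_apply, smul_eq_mul]
    rw [sq, sum_mul_sum]
    refine sum_congr rfl fun a _ => ?_
    rw [sum_eq_single a]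
    · ring
    · intro a' _ ha'
      linear_combination (c a * c a') * hFB a a' ha'.symm b b.2
    · simp
  have henergy : ∀ c : Fin (k + 1) → ℝ,
      dirichletForm Γ (∑ a, c a • F a) (∑ a, c a • F a) =
        ∑ a, c a ^ 2 * dirichletForm Γ (F a) (F a) := by
    intro c
    rw [dirichletForm_sum_left]
    refine sum_congr rfl fun a _ => ?_
    rw [dirichletForm_smul_left, dirichletForm_comm, dirichletForm_sum_left, sum_eq_single a]
    · rw [dirichletForm_smul_left]; ring
    · intro a' _ ha'
      rw [dirichletForm_smul_left, hFD a' a ha', mul_zero]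
    · simp
  have hli : LinearIndependent ℝ F := by
    rw [Fintype.linearIndependent_iff]
    intro c hc a
    have h0 := hmass c
    rw [hc] at h0
    simp only [Pi.zero_apply, ne_eq, OfNat.ofNat_ne_zero, not_false_eq_true, zero_pow,
      sum_const_zero] at h0
    rw [eq_comm, sum_eq_zero_iff_of_nonneg
      fun a _ => mul_nonneg (sq_nonneg _) (hpos a).le] at h0
    exact pow_eq_zero_iff two_ne_zero |>.1
      ((mul_eq_zero.1 (h0 a (mem_univ a))).resolve_right (hpos a).ne')
  have hcount : k + 1 ≤ steklovCount Γ B s := by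
    have h1 : Module.finrank ℝ (Submodule.span ℝ (Set.range F)) = k + 1 := by
      rw [finrank_span_eq_card hli, Fintype.card_fin]
    rw [← h1]
    refine finrank_le_steklovCount huniq s _ (fun u hu hu0 => ?_) fun u hu => ?_
    · obtain ⟨c, rfl⟩ := (Submodule.mem_span_range_iff_exists_fun ℝ).1 hu
      rw [hmass]
      obtain ⟨a, ha⟩ : ∃ a, c a ≠ 0 := by
        by_contra! h
        exact hu0 (by simp [h])
      exact sum_pos' (fun a _ => mul_nonneg (sq_nonneg _) (hpos a).le)
        ⟨a, mem_univ a, mul_pos (sq_pos_of_ne_zero ha) (hpos a)⟩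
    · obtain ⟨c, rfl⟩ := (Submodule.mem_span_range_iff_exists_fun ℝ).1 hu
      rw [hmass, henergy, mul_sum]
      refine sum_le_sum fun a _ => ?_
      have := mul_le_mul_of_nonneg_left (hF a) (sq_nonneg (c a))
      linarith
  have hlow : ∀ t ∈ {t : ℝ | k + 1 ≤ steklovCount Γ B t}, 0 ≤ t := by
    intro t ht
    by_contra! h
    have : k + 1 ≤ 0 := steklovCount_eq_zero_of_neg huniq h ▸ ht
    omega
  exact ⟨Real.sInf_nonneg hlow, csInf_le ⟨0, hlow⟩ hcount⟩

end MinMax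

/-! ### An isoperimetric inequality in groups -/

section Isoperimetry

variable {G : Type*} [Group G]

open Classical in
/-- Translating `A` on the right along one edge moves at most `#D` further points out of `A`,
where `D` contains the boundary of `A`. -/
theorem card_filter_mul_notMem_le_add (S A D : Finset G)
    (hD : ∀ j ∉ A, (∃ i ∈ A, (cayleyGraph S).Adj i j) → j ∈ D) {u v : G}
    (p : (cayleyGraph S).Walk u v) :
    #{a ∈ A | a * v ∉ A} ≤ #{a ∈ A | a * u ∉ A} + p.length * #D := by
  induction p with
  | nil => simp
  | @cons u v w h p ih =>
    have hstep : #{a ∈ A | a * v ∉ A} ≤ #{a ∈ A | a * u ∉ A} + #D := by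
      have hsub : {a ∈ A | a * v ∉ A} ⊆
          {a ∈ A | a * u ∉ A} ∪ {a ∈ A | a * u ∈ A ∧ a * v ∉ A} := by
        intro a
        simp only [mem_filter, mem_union]
        tauto
      refine (card_le_card hsub).trans ((card_union_le _ _).trans (Nat.add_le_add_left ?_ _))
      refine card_le_card_of_injOn (· * v) (fun a ha => ?_) (mul_left_injective v).injOn
      simp only [coe_filter, Set.mem_ofPred_eq] at ha
      exact hD _ ha.2.2 ⟨a * u, ha.2.1, SimpleGraph.mulCayley_adj_mul_iff_right.2 h⟩
    rw [SimpleGraph.Walk.length_cons, add_mul, one_mul]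
    omega

/-- The isoperimetric inequality of Coulhon and Saloff-Coste: if a ball `U` of radius `n` has at
least twice as many points as `A`, then the boundary of `A` has at least `#A / (2 n)` points. On
average over `g ∈ U`, half of `A` leaves `A` under right translation by `g`, while the translation
by a single `g` moves at most `n * #D` points out of `A`. -/
theorem card_le_two_mul_mul_card_boundary {S : Finset G} (hconn : (cayleyGraph S).Connected)
    {A D U : Finset G} {n : ℕ} (hD : ∀ j ∉ A, (∃ i ∈ A, (cayleyGraph S).Adj i j) → j ∈ D)
    (hU : ∀ g ∈ U, (cayleyGraph S).dist 1 g ≤ n) (hAU : 2 * #A ≤ #U) :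
    #A ≤ 2 * n * #D := by
  classical
  have hupper : ∀ g ∈ U, #{a ∈ A | a * g ∉ A} ≤ n * #D := by
    intro g hg
    obtain ⟨p, hp⟩ := hconn.exists_walk_length_eq_dist 1 g
    have h := card_filter_mul_notMem_le_add S A D hD p
    have h1 : #{a ∈ A | a * 1 ∉ A} = 0 := by simp
    rw [h1, zero_add, hp] at h
    exact h.trans (Nat.mul_le_mul_right _ (hU g hg))
  have hlower : ∀ a ∈ A, #U ≤ #{g ∈ U | a * g ∉ A} + #A := by
    intro a _
    have h1 : #{g ∈ U | a * g ∈ A} ≤ #A :=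
      card_le_card_of_injOn (a * ·) (fun g hg => (mem_filter.1 hg).2)
        (mul_right_injective a).injOn
    have h2 := card_filter_add_card_filter_not (s := U) (fun g => a * g ∈ A)
    omega
  have hswap : ∑ g ∈ U, #{a ∈ A | a * g ∉ A} = ∑ a ∈ A, #{g ∈ U | a * g ∉ A} := by
    simp only [card_filter]
    exact sum_comm
  have h1 := sum_le_sum hupper
  have h2 := sum_le_sum hlower
  rw [hswap, sum_const, smul_eq_mul] at h1
  rw [sum_add_distrib, sum_const, sum_const, smul_eq_mul, smul_eq_mul] at h2
  rcases Nat.eq_zero_or_pos #U with h0 | h0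
  · omega
  · refine Nat.le_of_mul_le_mul_left ?_ h0
    nlinarith

end Isoperimetry

/-! ### Boundary points away from a few balls -/

section Homogeneous

variable {V : Type*} {Γ : SimpleGraph V} {ball : V → ℕ → Finset V} {vol : ℕ → ℕ}

/-- Among the spheres with radii in `(m, 2 m]`, one has at most the average size. -/
theorem exists_radius_card_sphere_le [DecidableEq V]
    (hball : ∀ x n y, y ∈ ball x n ↔ Γ.dist x y ≤ n) (hvol : ∀ x n, #(ball x n) = vol n)
    [Nonempty V] {m : ℕ} (hm : 0 < m) :
    ∃ ρ, m < ρ ∧ ρ ≤ 2 * m ∧ ∀ x, m * #{y ∈ ball x ρ | Γ.dist x y = ρ} ≤ vol (2 * m) := by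
  have hsphere : ∀ x n, #{y ∈ ball x (n + 1) | Γ.dist x y = n + 1} + vol n = vol (n + 1) := by
    intro x n
    rw [← hvol x n, ← hvol x (n + 1), ← card_union_of_disjoint]
    · congr 1
      ext y
      simp only [mem_union, mem_filter, hball]
      omega
    · rw [disjoint_left]
      intro y hy hy'
      rw [mem_filter] at hy
      rw [hball] at hy'
      omega
  -- otherwise the spheres with radii in `(m, 2 m]` would together exceed the ball of radius `2 m`
  by_contra! hcon
  have hgrow : ∀ i ≤ m, vol m + i * (vol (2 * m) / m + 1) ≤ vol (m + i) := by
    intro i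
    induction i with
    | zero => simp
    | succ i ih =>
      intro hi
      obtain ⟨x, hx⟩ := hcon (m + i + 1) (by omega) (by omega)
      have h1 := hsphere x (m + i)
      have h2 : vol (2 * m) / m < #{y ∈ ball x (m + i + 1) | Γ.dist x y = m + i + 1} := by
        rw [Nat.div_lt_iff_lt_mul hm]
        linarith
      have h3 := ih (by omega)
      rw [add_mul, one_mul, ← add_assoc m i 1]
      omega
  have h1 := hgrow m le_rfl
  have h2 := Nat.lt_mul_div_succ (vol (2 * m)) hm
  rw [← two_mul] at h1
  omega

open Classical in
/-- Few balls of small radius cannot carry most of the boundary `B` of `A`: the isoperimetric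
inequality applies to `A` with slightly larger balls removed, and their radius can be chosen such
that removing them creates little new boundary. -/
theorem card_le_card_boundary_far (hconn : Γ.Connected)
    (hball : ∀ x n y, y ∈ ball x n ↔ Γ.dist x y ≤ n) (hvol : ∀ x n, #(ball x n) = vol n)
    {A B T : Finset V} {N K r : ℕ}
    (hB : ∀ j ∉ A, (∃ i ∈ A, Γ.Adj i j) → j ∈ B)
    (hiso : ∀ A' ⊆ A, ∀ D : Finset V, (∀ j ∉ A', (∃ i ∈ A', Γ.Adj i j) → j ∈ D) →
      #A' ≤ 2 * N * #D)
    (hr : 0 < r) (hT : #T ≤ K) (hK : 2 * (K * vol (10 * r)) ≤ #A)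
    (hKN : 8 * N * (K * vol (10 * r)) ≤ 5 * r * #A) :
    #A ≤ 8 * N * #{b ∈ B | ∀ x ∈ T, 5 * r < Γ.dist x b} := by
  have := hconn.nonempty
  obtain ⟨ρ, hρ, hρ', hsph⟩ := exists_radius_card_sphere_le hball hvol (m := 5 * r) (by omega)
  rw [show 2 * (5 * r) = 10 * r by ring] at hρ' hsph
  set far := {b ∈ B | ∀ x ∈ T, 5 * r < Γ.dist x b}
  let sph : Finset V := T.biUnion fun x => {y ∈ ball x ρ | Γ.dist x y = ρ}
  let A' : Finset V := A \ T.biUnion fun x => ball x ρ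
  have hsph_card : 5 * r * #sph ≤ K * vol (10 * r) := by
    calc 5 * r * #sph ≤ 5 * r * ∑ x ∈ T, #{y ∈ ball x ρ | Γ.dist x y = ρ} :=
          Nat.mul_le_mul_left _ card_biUnion_le
      _ = ∑ x ∈ T, 5 * r * #{y ∈ ball x ρ | Γ.dist x y = ρ} := mul_sum _ _ _
      _ ≤ ∑ x ∈ T, vol (10 * r) := sum_le_sum fun x _ => hsph x
      _ ≤ K * vol (10 * r) := by
          rw [sum_const, smul_eq_mul]
          exact Nat.mul_le_mul_right _ hT
  have hA'_card : #A ≤ #A' + K * vol (10 * r) := by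
    have h1 : #(T.biUnion fun x => ball x ρ) ≤ K * vol (10 * r) := by
      calc #(T.biUnion fun x => ball x ρ) ≤ ∑ x ∈ T, #(ball x ρ) := card_biUnion_le
        _ ≤ ∑ x ∈ T, vol (10 * r) := by
            refine sum_le_sum fun x _ => ?_
            rw [← hvol x]
            refine card_le_card fun y hy => ?_
            rw [hball] at hy ⊢
            omega
        _ ≤ K * vol (10 * r) := by
            rw [sum_const, smul_eq_mul]
            exact Nat.mul_le_mul_right _ hT
    have h2 := le_card_sdiff (T.biUnion fun x => ball x ρ) A
    change _ ≤ #A' at h2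
    omega
  have hbd : ∀ j ∉ A', (∃ i ∈ A', Γ.Adj i j) → j ∈ far ∪ sph := by
    rintro j hj ⟨i, hi, hij⟩
    simp only [A', Finset.mem_sdiff, mem_biUnion, not_exists, not_and, hball, not_le] at hi hj
    by_cases hnear : ∃ x ∈ T, Γ.dist x j ≤ ρ
    · obtain ⟨x, hx, hxj⟩ := hnear
      refine mem_union_right _ (mem_biUnion.2 ⟨x, hx, ?_⟩)
      rw [mem_filter, hball]
      refine ⟨hxj, hxj.antisymm ?_⟩
      have h1 := hi.2 x hx
      have h2 := hconn.dist_triangle (u := x) (v := j) (w := i)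
      rw [SimpleGraph.dist_eq_one_iff_adj.2 hij.symm] at h2
      omega
    · push Not at hnear
      refine mem_union_left _ (mem_filter.2 ⟨hB j ?_ ⟨i, hi.1, hij⟩, fun x hx => ?_⟩)
      · intro hjA
        obtain ⟨x, hx, hxj⟩ : ∃ x ∈ T, Γ.dist x j ≤ ρ := by
          by_contra! h
          exact hj hjA h
        exact absurd hxj (not_le.2 (hnear x hx))
      · exact hρ.trans (hnear x hx)
  have h1 := hiso A' sdiff_subset _ hbd
  have h2 : 2 * N * #(far ∪ sph) ≤ 2 * N * (#far + #sph) :=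
    Nat.mul_le_mul_left _ (card_union_le _ _)
  have h3 : 8 * N * #sph ≤ #A := by
    refine Nat.le_of_mul_le_mul_left (c := 5 * r) ?_ (by omega)
    calc 5 * r * (8 * N * #sph) = 8 * N * (5 * r * #sph) := by ring
      _ ≤ 8 * N * (K * vol (10 * r)) := Nat.mul_le_mul_left _ hsph_card
      _ ≤ 5 * r * #A := hKN
  nlinarith

/-! ### Test functions -/

/-- The tent of radius `2 r` centred at `x`: the function `y ↦ max (2 r - d(x, y)) 0`, written
with the truncated subtraction of natural numbers. -/
noncomputable def tent (Γ : SimpleGraph V) (r : ℕ) (x y : V) : ℝ :=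
  ((2 * r - Γ.dist x y : ℕ) : ℝ)

theorem tent_ne_zero_iff {r : ℕ} {x y : V} : tent Γ r x y ≠ 0 ↔ Γ.dist x y < 2 * r := by
  rw [tent, Nat.cast_ne_zero]
  omega

theorem le_tent {r : ℕ} {x y : V} (h : Γ.dist x y ≤ r) : (r : ℝ) ≤ tent Γ r x y := by
  rw [tent, Nat.cast_le]
  omega

/-- Tents are `1`-Lipschitz. -/
theorem sq_tent_sub_tent_le_one (hconn : Γ.Connected) (r : ℕ) (x : V) {i j : V}
    (hij : Γ.Adj i j) : (tent Γ r x i - tent Γ r x j) ^ 2 ≤ 1 := by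
  have h1 := hconn.dist_triangle (u := x) (v := i) (w := j)
  have h2 := hconn.dist_triangle (u := x) (v := j) (w := i)
  rw [SimpleGraph.dist_eq_one_iff_adj.2 hij] at h1
  rw [SimpleGraph.dist_eq_one_iff_adj.2 hij.symm] at h2
  rw [sq_le_one_iff_abs_le_one, abs_sub_le_iff, tent, tent]
  constructor
  · rw [sub_le_iff_le_add]
    exact_mod_cast (by omega : 2 * r - Γ.dist x i ≤ 1 + (2 * r - Γ.dist x j))
  · rw [sub_le_iff_le_add]
    exact_mod_cast (by omega : 2 * r - Γ.dist x j ≤ 1 + (2 * r - Γ.dist x i))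

/-- The supports of tents with centres at distance at least `4 r` are disjoint and not joined by
an edge. -/
theorem tent_eq_zero_or (hconn : Γ.Connected) {r : ℕ} {x y i j : V} (hxy : 4 * r ≤ Γ.dist x y)
    (hij : Γ.dist i j ≤ 1) : tent Γ r x i = 0 ∨ tent Γ r y j = 0 := by
  by_contra! h
  rw [tent_ne_zero_iff, tent_ne_zero_iff] at h
  have h1 := hconn.dist_triangle (u := x) (v := i) (w := y)
  have h2 := hconn.dist_triangle (u := i) (v := j) (w := y)
  rw [Γ.dist_comm (u := j)] at h2
  omega

open Classical in
/-- Averaging over all tents with centre close to `far` produces one whose energy on the edge set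
`E` is small compared to its mass on `B`. -/
theorem exists_tent (hconn : Γ.Connected)
    (hball : ∀ x n y, y ∈ ball x n ↔ Γ.dist x y ≤ n) (hvol : ∀ x n, #(ball x n) = vol n)
    {B far : Finset V} {E : Finset (V × V)} (hE : ∀ e ∈ E, Γ.Adj e.1 e.2) {r : ℕ} (hr : 0 < r)
    (hfar : far ⊆ B) (hfar0 : far.Nonempty) :
    ∃ b ∈ far, ∃ x, Γ.dist b x ≤ r ∧ 0 < ∑ b ∈ B, tent Γ r x b ^ 2 ∧
      (#far * (vol r * (r : ℝ) ^ 2)) * ∑ e ∈ E, (tent Γ r x e.1 - tent Γ r x e.2) ^ 2 ≤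
        (#E * (2 * vol (2 * r))) * ∑ b ∈ B, tent Γ r x b ^ 2 := by
  let X : Finset V := far.biUnion fun b => ball b r
  have hX : ∀ x ∈ X, ∃ b ∈ far, Γ.dist b x ≤ r := by
    intro x hx
    obtain ⟨b, hb, hbx⟩ := mem_biUnion.1 hx
    exact ⟨b, hb, (hball _ _ _).1 hbx⟩
  have hX0 : X.Nonempty := by
    obtain ⟨b, hb⟩ := hfar0
    exact ⟨b, mem_biUnion.2 ⟨b, hb, (hball _ _ _).2 (by simp)⟩⟩
  have hmass : #far * (vol r * (r : ℝ) ^ 2) ≤ ∑ x ∈ X, ∑ b ∈ B, tent Γ r x b ^ 2 := by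
    rw [sum_comm]
    refine le_trans ?_ (sum_le_sum_of_subset_of_nonneg hfar
      fun b _ _ => sum_nonneg fun x _ => sq_nonneg _)
    rw [← nsmul_eq_mul, ← sum_const]
    refine sum_le_sum fun b hb => ?_
    have hsub : ball b r ⊆ X := fun x hx => mem_biUnion.2 ⟨b, hb, hx⟩
    refine le_trans ?_ (sum_le_sum_of_subset_of_nonneg hsub fun x _ _ => sq_nonneg _)
    rw [← hvol b, ← nsmul_eq_mul, ← sum_const]
    refine sum_le_sum fun x hx => ?_
    have h := le_tent (Γ := Γ) (r := r) (x := x) (y := b)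
      (by rw [Γ.dist_comm]; exact (hball _ _ _).1 hx)
    gcongr
  have henergy : ∑ x ∈ X, ∑ e ∈ E, (tent Γ r x e.1 - tent Γ r x e.2) ^ 2 ≤
      #E * (2 * vol (2 * r)) := by
    rw [sum_comm, ← nsmul_eq_mul, ← sum_const]
    refine sum_le_sum fun e he => ?_
    have h1 : ∀ x ∈ X, (tent Γ r x e.1 - tent Γ r x e.2) ^ 2 ≤
        if x ∈ ball e.1 (2 * r) ∪ ball e.2 (2 * r) then (1 : ℝ) else 0 := by
      intro x _
      split_ifs with h
      · exact sq_tent_sub_tent_le_one hconn r x (hE e he)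
      · have hz : ∀ y, x ∉ ball y (2 * r) → tent Γ r x y = 0 := by
          intro y hy
          by_contra hne
          rw [← ne_eq, tent_ne_zero_iff, Γ.dist_comm] at hne
          exact hy ((hball _ _ _).2 hne.le)
        rw [mem_union, not_or] at h
        rw [hz _ h.1, hz _ h.2]
        simp
    refine (sum_le_sum h1).trans ?_
    rw [← sum_filter, sum_const, nsmul_eq_mul, mul_one]
    have h2 : #{x ∈ X | x ∈ ball e.1 (2 * r) ∪ ball e.2 (2 * r)} ≤ 2 * vol (2 * r) := by
      refine (card_le_card (t := ball e.1 (2 * r) ∪ ball e.2 (2 * r))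
        fun x hx => (mem_filter.1 hx).2).trans ((card_union_le _ _).trans ?_)
      rw [hvol, hvol]
      omega
    exact_mod_cast h2
  obtain ⟨x, hx, hle⟩ := exists_le_of_sum_le hX0
    (f := fun x => (#far * (vol r * (r : ℝ) ^ 2)) *
      ∑ e ∈ E, (tent Γ r x e.1 - tent Γ r x e.2) ^ 2)
    (g := fun x => (#E * (2 * vol (2 * r) : ℝ)) * ∑ b ∈ B, tent Γ r x b ^ 2) (by
      rw [← mul_sum, ← mul_sum, mul_comm]
      exact mul_le_mul henergy hmass (by positivity) (by positivity))
  obtain ⟨b, hb, hbx⟩ := hX x hx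
  refine ⟨b, hb, x, hbx, ?_, hle⟩
  refine sum_pos' (fun b _ => sq_nonneg _) ⟨b, hfar hb, ?_⟩
  have h := le_tent (Γ := Γ) (r := r) (x := x) (y := b) (by rwa [Γ.dist_comm])
  have hr' : (0 : ℝ) < r := by exact_mod_cast hr
  exact pow_pos (hr'.trans_le h) 2

open Classical in
/-- Greedy choice of `k + 1` tents with separated centres and small Rayleigh quotients: since no
`k` balls of radius `5 r` carry most of the boundary, another tent can be found away from the
previous ones. -/
theorem exists_separated_tents (hconn : Γ.Connected)
    (hball : ∀ x n y, y ∈ ball x n ↔ Γ.dist x y ≤ n) (hvol : ∀ x n, #(ball x n) = vol n)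
    {A B : Finset V} {E : Finset (V × V)} (hE : ∀ e ∈ E, Γ.Adj e.1 e.2) {N r k : ℕ} (hr : 0 < r)
    {ε : ℝ} (hA : 0 < #A)
    (hfar : ∀ T : Finset V, #T ≤ k → #A ≤ 8 * N * #{b ∈ B | ∀ x ∈ T, 5 * r < Γ.dist x b})
    (hε : 8 * N * (#E * (2 * vol (2 * r))) ≤ ε * (#A * (vol r * (r : ℝ) ^ 2))) :
    ∃ T : Finset V, #T = k + 1 ∧ (∀ x ∈ T, ∀ y ∈ T, x ≠ y → 4 * r ≤ Γ.dist x y) ∧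
      ∀ x ∈ T, 0 < ∑ b ∈ B, tent Γ r x b ^ 2 ∧
        ∑ e ∈ E, (tent Γ r x e.1 - tent Γ r x e.2) ^ 2 ≤ ε * ∑ b ∈ B, tent Γ r x b ^ 2 := by
  suffices h : ∀ m ≤ k + 1, ∃ T : Finset V, #T = m ∧
      (∀ x ∈ T, ∀ y ∈ T, x ≠ y → 4 * r ≤ Γ.dist x y) ∧
      ∀ x ∈ T, 0 < ∑ b ∈ B, tent Γ r x b ^ 2 ∧
        ∑ e ∈ E, (tent Γ r x e.1 - tent Γ r x e.2) ^ 2 ≤ ε * ∑ b ∈ B, tent Γ r x b ^ 2 from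
    h (k + 1) le_rfl
  intro m
  induction m with
  | zero => exact fun _ => ⟨∅, by simp⟩
  | succ m ih =>
    intro hm
    obtain ⟨T, hTm, hTsep, hT⟩ := ih (by omega)
    have hAfar := hfar T (by omega)
    set far := {b ∈ B | ∀ x ∈ T, 5 * r < Γ.dist x b} with hfar_def
    have hfar0 : far.Nonempty := by
      rw [← card_pos]
      by_contra! h
      rw [Nat.le_zero.1 h] at hAfar
      omega
    obtain ⟨b, hb, x, hbx, hmass, hle⟩ :=
      exists_tent hconn hball hvol hE hr (filter_subset _ B : far ⊆ B) hfar0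
    have hxT : ∀ t ∈ T, 4 * r ≤ Γ.dist t x := by
      intro t ht
      have h1 := (mem_filter.1 hb).2 t ht
      have h2 := hconn.dist_triangle (u := t) (v := x) (w := b)
      rw [Γ.dist_comm (u := x)] at h2
      omega
    have hx : x ∉ T := fun h => by
      have := hxT x h
      rw [SimpleGraph.dist_self] at this
      omega
    refine ⟨insert x T, by rw [card_insert_of_notMem hx, hTm], ?_, ?_⟩
    · intro y hy z hz hyz
      rw [mem_insert] at hy hz
      rcases hy with rfl | hy <;> rcases hz with rfl | hz
      · exact absurd rfl hyz
      · rw [Γ.dist_comm]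
        exact hxT z hz
      · exact hxT y hy
      · exact hTsep y hy z hz hyz
    · intro y hy
      rw [mem_insert] at hy
      rcases hy with rfl | hy
      · refine ⟨hmass, ?_⟩
        have hvol0 : 0 < vol r := by
          rw [← hvol b, card_pos]
          exact ⟨b, (hball _ _ _).2 (by simp)⟩
        have hc : (0 : ℝ) < #A * (vol r * (r : ℝ) ^ 2) := by positivity
        refine le_of_mul_le_mul_left ?_ hc
        set Q := ∑ e ∈ E, (tent Γ r y e.1 - tent Γ r y e.2) ^ 2
        have hQ : 0 ≤ Q := sum_nonneg fun e _ => sq_nonneg _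
        have hAfar' : (#A : ℝ) ≤ 8 * N * #far := by exact_mod_cast hAfar
        calc #A * (vol r * (r : ℝ) ^ 2) * Q
            ≤ 8 * N * #far * (vol r * (r : ℝ) ^ 2) * Q := by gcongr
          _ = 8 * N * (#far * (vol r * (r : ℝ) ^ 2) * Q) := by ring
          _ ≤ 8 * N * (#E * (2 * vol (2 * r)) * ∑ b ∈ B, tent Γ r y b ^ 2) := by gcongr
          _ = 8 * N * (#E * (2 * vol (2 * r))) * ∑ b ∈ B, tent Γ r y b ^ 2 := by ring
          _ ≤ ε * (#A * (vol r * (r : ℝ) ^ 2)) * ∑ b ∈ B, tent Γ r y b ^ 2 := by gcongr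
          _ = _ := by ring
      · exact hT y hy

end Homogeneous

/-! ### Test functions on a subgraph -/

section Subgraph

variable {V : Type*} {Γ : SimpleGraph V} {Ω : Set V} [Fintype (vertexClosure Γ Ω)]

/-- On a connected subgraph with nonempty boundary, a function of zero energy that vanishes on
the boundary is zero. -/
theorem eq_zero_of_dirichletForm_eq_zero (hΩ : (Γ.induce Ω).Connected)
    (hB : (vertexBoundary Γ Ω).Nonempty) (u : vertexClosure Γ Ω → ℝ)
    (hu : dirichletForm (closureGraph Γ Ω) u u = 0)
    (huB : ∀ b ∈ closureBoundary Γ Ω, u b = 0) : u = 0 := by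
  have hconst : ∀ i j : Ω, (Γ.induce Ω).Reachable i j →
      u ⟨i, Or.inl i.2⟩ = u ⟨j, Or.inl j.2⟩ := by
    rintro i j ⟨p⟩
    induction p with
    | nil => rfl
    | @cons i j _ h p ih =>
      have hij : Γ.Adj i j := h
      have hadj : (closureGraph Γ Ω).Adj ⟨i, Or.inl i.2⟩ ⟨j, Or.inl j.2⟩ := ⟨hij, Or.inl i.2⟩
      exact (eq_of_adj_of_dirichletForm_eq_zero hu hadj).trans ih
  obtain ⟨b, hb⟩ := hB
  obtain ⟨-, i, hi, hib⟩ := id hb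
  have hi0 : u ⟨i, Or.inl hi⟩ = 0 := by
    rw [← huB ⟨b, Or.inr hb⟩ hb]
    exact eq_of_adj_of_dirichletForm_eq_zero hu (Γ := closureGraph Γ Ω) ⟨hib, Or.inl hi⟩
  funext j
  rcases j.2 with hj | hj
  · exact (hconst ⟨j, hj⟩ ⟨i, hi⟩ (hΩ.preconnected _ _)).trans hi0
  · exact huB j hj

/-- The energy of a function on `(Ω, B)` is at most its energy on any set of oriented edges that
contains those starting in `Ω`. -/
theorem dirichletForm_closureGraph_le {E : Finset (V × V)}
    (hE : ∀ i ∈ Ω, ∀ j, Γ.Adj i j → (i, j) ∈ E) (f : V → ℝ) :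
    dirichletForm (closureGraph Γ Ω) (fun i => f i) (fun i => f i) ≤
      ∑ e ∈ E, (f e.1 - f e.2) ^ 2 := by
  classical
  let g : vertexClosure Γ Ω → vertexClosure Γ Ω → ℝ := fun i j =>
    if Γ.Adj i j ∧ (i : V) ∈ Ω then (f i - f j) ^ 2 else 0
  have hg : ∀ i j, 0 ≤ g i j := fun i j => by
    simp only [g]
    split_ifs
    · exact sq_nonneg _
    · exact le_rfl
  have h1 : ∑ i, ∑ j with (closureGraph Γ Ω).Adj i j, (f i - f j) * (f i - f j) ≤
      ∑ i, ∑ j, g i j + ∑ i, ∑ j, g i j := by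
    nth_rw 2 [sum_comm]
    rw [← sum_add_distrib]
    refine sum_le_sum fun i _ => ?_
    rw [← sum_add_distrib, sum_filter]
    refine sum_le_sum fun j _ => ?_
    split_ifs with h
    · rcases h with ⟨hij, hi | hj⟩
      · have : g i j = (f i - f j) ^ 2 := if_pos ⟨hij, hi⟩
        nlinarith [hg j i]
      · have : g j i = (f j - f i) ^ 2 := if_pos ⟨hij.symm, hj⟩
        nlinarith [hg i j]
    · exact add_nonneg (hg i j) (hg j i)
  have h2 : ∑ i, ∑ j, g i j ≤ ∑ e ∈ E, (f e.1 - f e.2) ^ 2 := by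
    rw [← sum_product', ← sum_filter, univ_product_univ]
    let P : Finset (vertexClosure Γ Ω × vertexClosure Γ Ω) :=
      {p | Γ.Adj p.1 p.2 ∧ (p.1 : V) ∈ Ω}
    let π : vertexClosure Γ Ω × vertexClosure Γ Ω → V × V := Prod.map Subtype.val Subtype.val
    have hinj : Set.InjOn π (P : Set (vertexClosure Γ Ω × vertexClosure Γ Ω)) :=
      (Subtype.val_injective.prodMap Subtype.val_injective).injOn
    calc ∑ p ∈ P, (f p.1 - f p.2) ^ 2
        = ∑ e ∈ P.image π, (f e.1 - f e.2) ^ 2 := by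
          rw [sum_image hinj]
          rfl
      _ ≤ _ := by
          refine sum_le_sum_of_subset_of_nonneg ?_ fun e _ _ => sq_nonneg _
          intro e he
          obtain ⟨p, hp, rfl⟩ := mem_image.1 he
          have := (mem_filter.1 hp).2
          exact hE _ this.2 _ this.1
  rw [dirichletForm_eq]
  linarith

open Classical in
theorem sum_closureBoundary {B : Finset V} (hB : ∀ j, j ∈ B ↔ j ∈ vertexBoundary Γ Ω)
    (f : V → ℝ) : ∑ b : closureBoundary Γ Ω, f b = ∑ b ∈ B, f b := by
  refine sum_bij (fun b _ => ((b : vertexClosure Γ Ω) : V)) (fun b _ => (hB _).2 b.2)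
    (fun b _ b' _ h => Subtype.ext (Subtype.ext h)) (fun j hj => ?_) fun b _ => rfl
  have hj' := (hB j).1 hj
  exact ⟨⟨⟨j, Or.inr hj'⟩, hj'⟩, mem_univ _, rfl⟩

/-- Separated tents of small Rayleigh quotient bound the Steklov eigenvalues, and each occupies
its own part of the boundary. -/
theorem steklovEigenvalue_mem_Icc_of_tents (hconn : Γ.Connected) (hΩ : (Γ.induce Ω).Connected)
    {B : Finset V} (hB : ∀ j, j ∈ B ↔ j ∈ vertexBoundary Γ Ω) {E : Finset (V × V)}
    (hE : ∀ i ∈ Ω, ∀ j, Γ.Adj i j → (i, j) ∈ E) {r k : ℕ} {ε : ℝ} {T : Finset V}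
    (hTcard : #T = k + 1) (hTsep : ∀ x ∈ T, ∀ y ∈ T, x ≠ y → 4 * r ≤ Γ.dist x y)
    (hpos : ∀ x ∈ T, 0 < ∑ b ∈ B, tent Γ r x b ^ 2)
    (hT : ∀ x ∈ T, ∑ e ∈ E, (tent Γ r x e.1 - tent Γ r x e.2) ^ 2 ≤
      ε * ∑ b ∈ B, tent Γ r x b ^ 2) :
    k < #B ∧ steklovEigenvalue (closureGraph Γ Ω) (closureBoundary Γ Ω) k ∈ Set.Icc 0 ε := by
  classical
  have hsupp : ∀ x ∈ T, ∃ b ∈ B, tent Γ r x b ≠ 0 := by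
    intro x hx
    obtain ⟨b, hb, hne⟩ := exists_ne_zero_of_sum_ne_zero (hpos x hx).ne'
    exact ⟨b, hb, fun h => hne (by rw [h]; simp)⟩
  constructor
  · choose! p hpB hp using hsupp
    rw [← Nat.succ_le_iff, Nat.succ_eq_add_one, ← hTcard]
    refine card_le_card_of_injOn p hpB fun x hx y hy hxy => ?_
    by_contra hne
    rcases tent_eq_zero_or hconn (hTsep x hx y hy hne) (i := p x) (j := p x) (by simp) with h | h
    · exact hp x hx h
    · exact hp y hy (hxy ▸ h)
  · let e := T.equivFinOfCardEq hTcard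
    have hne : ∀ a a', a ≠ a' → 4 * r ≤ Γ.dist (e.symm a : V) (e.symm a') := fun a a' h =>
      hTsep _ (e.symm a).2 _ (e.symm a').2 fun h' => h (e.symm.injective (Subtype.ext h'))
    have hprod : ∀ a a', a ≠ a' → ∀ i j, Γ.dist i j ≤ 1 →
        tent Γ r (e.symm a) i * tent Γ r (e.symm a') j = 0 := fun a a' h i j hij =>
      mul_eq_zero.2 (tent_eq_zero_or hconn (hne a a' h) hij)
    have hBne : (vertexBoundary Γ Ω).Nonempty := by
      obtain ⟨x, hx⟩ : T.Nonempty := card_pos.1 (by omega)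
      obtain ⟨b, hb, -⟩ := hsupp x hx
      exact ⟨b, (hB b).1 hb⟩
    refine steklovEigenvalue_mem_Icc (eq_zero_of_dirichletForm_eq_zero hΩ hBne)
      (fun a i => tent Γ r (e.symm a) i) (fun a => ?_) (fun a => ?_) (fun a a' h => ?_)
      fun a a' h b _ => hprod a a' h _ _ (by simp)
    · rw [sum_closureBoundary hB fun b => tent Γ r (e.symm a) b ^ 2]
      exact hpos _ (e.symm a).2
    · rw [sum_closureBoundary hB fun b => tent Γ r (e.symm a) b ^ 2]
      exact (dirichletForm_closureGraph_le hE _).trans (hT _ (e.symm a).2)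
    · rw [dirichletForm_eq, div_eq_zero_iff]
      left
      refine sum_eq_zero fun i _ => sum_eq_zero fun j hj => ?_
      have hij : Γ.Adj i j := (mem_filter.1 hj).2.1
      have hd := (SimpleGraph.dist_eq_one_iff_adj.2 hij).le
      have hd' := (SimpleGraph.dist_eq_one_iff_adj.2 hij.symm).le
      linear_combination hprod a a' h i i (by simp) - hprod a a' h i j hd -
        hprod a a' h j i hd' + hprod a a' h j j (by simp)

end Subgraph

/-! ### Cayley graphs of polynomial growth -/

section Cayley

variable {G : Type*} [Group G] {S : Finset G}

theorem cayleyGraph_adj_iff (hS_symm : ∀ s ∈ S, s⁻¹ ∈ S) (hS_one : (1 : G) ∉ S) {i j : G} :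
    (cayleyGraph S).Adj i j ↔ i⁻¹ * j ∈ S := by
  rw [SimpleGraph.mulCayley_adj]
  constructor
  · rintro ⟨-, h | h⟩
    · exact h
    · simpa using hS_symm _ h
  · intro h
    refine ⟨?_, Or.inl h⟩
    rintro rfl
    exact hS_one (by simpa using h)

theorem cayleyGraph_connected (hS_symm : ∀ s ∈ S, s⁻¹ ∈ S) (hS_one : (1 : G) ∉ S)
    (hS_gen : Subgroup.closure (S : Set G) = ⊤) : (cayleyGraph S).Connected := by
  have hone : ∀ g : G, (cayleyGraph S).Reachable 1 g := by
    intro g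
    have hg : g ∈ Subgroup.closure (S : Set G) := hS_gen ▸ Subgroup.mem_top g
    induction hg using Subgroup.closure_induction_right with
    | one => exact .refl _
    | mul_right x _ s hs ih =>
      exact ih.trans (SimpleGraph.Adj.reachable
        ((cayleyGraph_adj_iff hS_symm hS_one).2 (by simpa using hs)))
    | mul_inv_cancel x _ s hs ih =>
      exact ih.trans (SimpleGraph.Adj.reachable
        ((cayleyGraph_adj_iff hS_symm hS_one).2 (by simpa using hS_symm s hs)))
  have : Nonempty G := ⟨1⟩
  exact ⟨fun g h => (hone g).symm.trans (hone h)⟩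

/-- Left translations are isometries of a Cayley graph. -/
theorem cayleyGraph_dist_mul_left (hconn : (cayleyGraph S).Connected) (g x y : G) :
    (cayleyGraph S).dist (g * x) (g * y) = (cayleyGraph S).dist x y := by
  have hle : ∀ g x y : G, (cayleyGraph S).dist (g * x) (g * y) ≤ (cayleyGraph S).dist x y := by
    intro g x y
    obtain ⟨p, hp⟩ := hconn.exists_walk_length_eq_dist x y
    let φ : cayleyGraph S →g cayleyGraph S :=
      ⟨(g * ·), fun h => SimpleGraph.mulCayley_adj_mul_iff_right.2 h⟩
    have h := SimpleGraph.dist_le (p.map φ)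
    rwa [SimpleGraph.Walk.length_map, hp] at h
  refine (hle g x y).antisymm ?_
  simpa using hle g⁻¹ (g * x) (g * y)

/-- The balls of a Cayley graph of polynomial growth are finite (as the growth function, a
cardinality with value `0` for infinite sets, is positive), and their cardinalities do not depend
on the centre. -/
theorem exists_ball (hconn : (cayleyGraph S).Connected) {d : ℕ}
    (hgrowth : HasPolynomialGrowth S d) :
    ∃ ball : G → ℕ → Finset G, (∀ x n y, y ∈ ball x n ↔ (cayleyGraph S).dist x y ≤ n) ∧
      ∀ x n, #(ball x n) = growthFunction S n := by
  obtain ⟨C, hC, hg⟩ := hgrowth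
  have hset : ∀ n : ℕ, {g : G | (cayleyGraph S).edist 1 g ≤ n} =
      {g : G | (cayleyGraph S).dist 1 g ≤ n} := by
    intro n
    ext g
    simp only [Set.mem_ofPred_eq]
    rw [← (hconn.preconnected 1 g).coe_dist_eq_edist, Nat.cast_le]
  have hfin1 : ∀ n, {g : G | (cayleyGraph S).dist 1 g ≤ n}.Finite := by
    intro n
    refine Set.Finite.subset (s := {g : G | (cayleyGraph S).dist 1 g ≤ n + 1}) ?_
      fun g hg => Nat.le_succ_of_le hg
    refine Set.finite_of_ncard_pos ?_
    rw [← hset (n + 1)]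
    change 0 < growthFunction S (n + 1)
    have h := (hg (n + 1) (by omega)).1
    have hp : 0 < C⁻¹ * ((n + 1 : ℕ) : ℝ) ^ d := by positivity
    exact_mod_cast hp.trans_le h
  have himage : ∀ x n, {y : G | (cayleyGraph S).dist x y ≤ n} =
      (x * ·) '' {g : G | (cayleyGraph S).dist 1 g ≤ n} := by
    intro x n
    ext y
    simp only [Set.mem_image, Set.mem_ofPred_eq]
    constructor
    · intro h
      refine ⟨x⁻¹ * y, ?_, by group⟩
      rw [← cayleyGraph_dist_mul_left hconn x]
      simpa using h
    · rintro ⟨g, hg, rfl⟩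
      have := cayleyGraph_dist_mul_left hconn x 1 g
      rw [mul_one] at this
      rwa [this]
  have hfin : ∀ x n, {y : G | (cayleyGraph S).dist x y ≤ n}.Finite := fun x n => by
    rw [himage]
    exact (hfin1 n).image _
  refine ⟨fun x n => (hfin x n).toFinset, fun x n y => by simp, fun x n => ?_⟩
  rw [← Set.ncard_eq_toFinset_card _ (hfin x n), himage,
    Set.ncard_image_of_injective _ (mul_right_injective x), growthFunction, hset]

/-- The choice of scales: for `A` large, there are radii `N` and `r` such that the ball of radius
`N` has about `2 * #A` points, `r` is large, `N / r` is bounded, and `K` balls of radius `10 r` are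
small compared to `A`, in the strong sense needed for cutting them out of `A`. The exponent
`d ≥ 2` enters here: the volume of these balls decays like `(r / N) ^ d`, which has to beat a
factor `N / r`. -/
theorem exists_scales {v : ℕ → ℕ} {d : ℕ} (hd : 2 ≤ d) {C : ℝ} (hC : 1 ≤ C)
    (hv : ∀ n : ℕ, 1 ≤ n → C⁻¹ * (n : ℝ) ^ d ≤ v n ∧ (v n : ℝ) ≤ C * (n : ℝ) ^ d)
    (hv0 : v 0 ≤ 1) (K : ℕ) :
    ∃ M : ℕ, 0 < M ∧ ∀ R : ℕ, ∃ a₀ : ℕ, 0 < a₀ ∧ ∀ a : ℕ, a₀ ≤ a → ∃ N r : ℕ,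
      2 * a ≤ v N ∧ 0 < r ∧ R ≤ r ∧ N ≤ 2 * M * r ∧ 2 * (K * v (10 * r)) ≤ a ∧
        8 * N * (K * v (10 * r)) ≤ 5 * r * a := by
  have hC0 : 0 < C := by linarith
  -- `L` is such that `M ^ d * v (10 * r) ≤ L * a` when `M * r ≤ N` and `N` is minimal with
  -- `2 * a ≤ v N`
  let L : ℝ := C * 10 ^ d * (2 ^ d * (2 * C))
  have hL : 0 < L := by positivity
  obtain ⟨M', hM'⟩ := exists_nat_ge (16 * K * L)
  let M := M' + 1
  have hM0 : 0 < M := Nat.succ_pos _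
  have hM0' : (0 : ℝ) < M := by exact_mod_cast hM0
  have hM : 16 * K * L ≤ (M : ℝ) := hM'.trans (by exact_mod_cast Nat.le_succ M')
  refine ⟨M, hM0, fun R => ?_⟩
  -- `a` large forces `N ≥ N₀`, which gives `r = N / M ≥ R + 1` and `N - 1 ≥ 1`
  let N₀ := M * (R + 1) + 2
  obtain ⟨a₀, ha₀⟩ := exists_nat_ge (C * (N₀ : ℝ) ^ d)
  refine ⟨a₀ + 1, Nat.succ_pos _, fun a ha => ?_⟩
  have ha0 : (0 : ℝ) < a := by exact_mod_cast (by omega : 0 < a)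
  have hex : ∃ n, 2 * a ≤ v n := by
    obtain ⟨n, hn⟩ := exists_nat_ge (C * (2 * a))
    have hn1 : (1 : ℝ) ≤ n := by
      have : (1 : ℝ) ≤ a := by exact_mod_cast (by omega : 1 ≤ a)
      nlinarith
    refine ⟨n, ?_⟩
    have h1 := (hv n (by exact_mod_cast hn1)).1
    have h2 : (n : ℝ) ≤ (n : ℝ) ^ d := le_self_pow₀ hn1 (by omega)
    have h3 : 2 * (a : ℝ) ≤ C⁻¹ * (n : ℝ) ^ d := by
      rw [le_inv_mul_iff₀ hC0]
      linarith
    exact_mod_cast h3.trans h1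
  let N := Nat.find hex
  have hN : 2 * a ≤ v N := Nat.find_spec hex
  have hNlt : v (N - 1) < 2 * a ∨ N = 0 := by
    rcases Nat.eq_zero_or_pos N with h | h
    · exact Or.inr h
    · exact Or.inl (not_le.1 (Nat.find_min hex (Nat.sub_lt h one_pos)))
  have hN1 : 1 ≤ N := by
    by_contra! h
    rw [Nat.lt_one_iff.1 h] at hN
    omega
  have hNN₀ : N₀ ≤ N := by
    by_contra! h
    have h1 := (hv N hN1).2
    have h2 : (N : ℝ) ^ d ≤ (N₀ : ℝ) ^ d := by
      have : (N : ℝ) ≤ N₀ := by exact_mod_cast h.le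
      gcongr
    have h3 : (2 * a : ℝ) ≤ v N := by exact_mod_cast hN
    have h4 : (a₀ : ℝ) < a := by exact_mod_cast (by omega : a₀ < a)
    nlinarith
  have hNd : (N : ℝ) ^ d ≤ 2 ^ d * (2 * C) * a := by
    have hN2 : 2 ≤ N := by omega
    have h1 := (hv (N - 1) (by omega)).1
    have h2 : (v (N - 1) : ℝ) < 2 * a := by
      exact_mod_cast hNlt.resolve_right (by omega)
    have h3 : ((N - 1 : ℕ) : ℝ) ^ d ≤ C * (2 * a) := by
      rw [← inv_mul_le_iff₀ hC0]
      exact (h1.trans_lt h2).le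
    have h4 : (N : ℝ) ≤ 2 * (N - 1 : ℕ) := by
      exact_mod_cast (by omega : N ≤ 2 * (N - 1))
    calc (N : ℝ) ^ d ≤ (2 * (N - 1 : ℕ)) ^ d := by gcongr
      _ = 2 ^ d * ((N - 1 : ℕ) : ℝ) ^ d := mul_pow _ _ _
      _ ≤ 2 ^ d * (C * (2 * a)) := by gcongr
      _ = _ := by ring
  let r := N / M
  have hRr : R + 1 ≤ r := by
    rw [Nat.le_div_iff_mul_le hM0]
    calc (R + 1) * M = M * (R + 1) := mul_comm _ _
      _ ≤ N := by omega
  have hMr : M * r ≤ N := Nat.mul_div_le N M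
  have hNr : N ≤ 2 * M * r := by
    have h1 : N < M * (r + 1) := Nat.lt_mul_div_succ N hM0
    have h2 : M ≤ M * r := Nat.le_mul_of_pos_right M (by omega)
    rw [mul_add, mul_one] at h1
    rw [mul_assoc, two_mul]
    omega
  have hsmall : 16 * M * (K * v (10 * r)) ≤ a := by
    have h1 : (M : ℝ) ^ 2 * v (10 * r) ≤ L * a := by
      have h2 := (hv (10 * r) (by omega)).2
      have h3 : (M : ℝ) ^ 2 ≤ (M : ℝ) ^ d :=
        pow_le_pow_right₀ (by exact_mod_cast hM0) hd
      have h4 : (M * r : ℝ) ^ d ≤ (N : ℝ) ^ d := by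
        have : (M * r : ℝ) ≤ N := by exact_mod_cast hMr
        gcongr
      calc (M : ℝ) ^ 2 * v (10 * r) ≤ (M : ℝ) ^ d * (C * ((10 * r : ℕ) : ℝ) ^ d) := by gcongr
        _ = C * 10 ^ d * (M * r : ℝ) ^ d := by push_cast; ring
        _ ≤ C * 10 ^ d * (2 ^ d * (2 * C) * a) := by
            have := h4.trans hNd
            gcongr
        _ = L * a := by simp only [L]; ring
    have h5 : (M : ℝ) * (16 * M * (K * v (10 * r))) ≤ M * a := by
      calc (M : ℝ) * (16 * M * (K * v (10 * r))) = 16 * K * ((M : ℝ) ^ 2 * v (10 * r)) := by ring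
        _ ≤ 16 * K * (L * a) := by gcongr
        _ = 16 * K * L * a := by ring
        _ ≤ M * a := by gcongr
    exact_mod_cast le_of_mul_le_mul_left h5 hM0'
  refine ⟨N, r, hN, by omega, by omega, hNr, ?_, ?_⟩
  · refine le_trans (Nat.mul_le_mul_right _ ?_) hsmall
    omega
  · calc 8 * N * (K * v (10 * r)) ≤ 8 * (2 * M * r) * (K * v (10 * r)) := by gcongr
      _ = r * (16 * M * (K * v (10 * r))) := by ring
      _ ≤ r * a := Nat.mul_le_mul_left _ hsmall
      _ ≤ 5 * r * a := Nat.mul_le_mul_right _ (by omega)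

/-- The quantitative core: subgraphs `(Ω, B)` of a Cayley graph of polynomial growth whose
interior is large enough have more than `k` boundary points and satisfy `σ_k ≤ ε`. -/
theorem exists_card_steklovEigenvalue_le (hS_symm : ∀ s ∈ S, s⁻¹ ∈ S) (hS_one : (1 : G) ∉ S)
    (hS_gen : Subgroup.closure (S : Set G) = ⊤) {d : ℕ} (hd : 2 ≤ d)
    (hgrowth : HasPolynomialGrowth S d) (k : ℕ) {ε : ℝ} (hε : 0 < ε) :
    ∃ a₀ : ℕ, ∀ Ω : Finset G, ((cayleyGraph S).induce (Ω : Set G)).Connected → a₀ ≤ #Ω →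
      k < (vertexBoundary (cayleyGraph S) (Ω : Set G)).ncard ∧
        subgraphSteklovEigenvalue S Ω k ∈ Set.Icc 0 ε := by
  classical
  have hconn := cayleyGraph_connected hS_symm hS_one hS_gen
  obtain ⟨ball, hball, hvol⟩ := exists_ball hconn hgrowth
  obtain ⟨C, hC, hg⟩ := hgrowth
  have hC0 : 0 < C := by linarith
  have hv0 : growthFunction S 0 ≤ 1 := by
    rw [← hvol 1 0, card_le_one]
    intro x hx y hy
    rw [hball, Nat.le_zero, hconn.dist_eq_zero_iff] at hx hy
    rw [← hx, hy]
  obtain ⟨M, hM0, hM⟩ := exists_scales hd hC hg hv0 k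
  -- for this `R`, the condition `R ≤ r` makes the Rayleigh quotients of the tents at most `ε`
  obtain ⟨R, hR⟩ := exists_nat_ge (32 * M * #S * (C * 2 ^ d * C) / ε)
  obtain ⟨a₀, ha₀, hscales⟩ := hM R
  refine ⟨a₀, fun Ω hΩ hcard => ?_⟩
  obtain ⟨N, r, hN, hr, hRr, hNr, hK, hKN⟩ := hscales #Ω hcard
  have hBfin : (vertexBoundary (cayleyGraph S) (Ω : Set G)).Finite :=
    (finite_vertexClosure S Ω).subset Set.subset_union_right
  let B := hBfin.toFinset
  have hB : ∀ j, j ∈ B ↔ j ∈ vertexBoundary (cayleyGraph S) (Ω : Set G) := fun j =>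
    hBfin.mem_toFinset
  let E : Finset (G × G) := (Ω ×ˢ S).image fun p => (p.1, p.1 * p.2)
  have hEadj : ∀ e ∈ E, (cayleyGraph S).Adj e.1 e.2 := by
    intro e he
    obtain ⟨p, hp, rfl⟩ := mem_image.1 he
    exact (cayleyGraph_adj_iff hS_symm hS_one).2 (by simpa using (mem_product.1 hp).2)
  have hE : ∀ i ∈ (Ω : Set G), ∀ j, (cayleyGraph S).Adj i j → (i, j) ∈ E := fun i hi j hij =>
    mem_image.2 ⟨(i, i⁻¹ * j),
      mem_product.2 ⟨hi, (cayleyGraph_adj_iff hS_symm hS_one).1 hij⟩, by simp⟩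
  have hEcard : (#E : ℝ) ≤ #Ω * #S := by
    have h : #E ≤ #(Ω ×ˢ S) := card_image_le
    rw [card_product] at h
    exact_mod_cast h
  have hiso : ∀ A' ⊆ Ω, ∀ D : Finset G,
      (∀ j ∉ A', (∃ i ∈ A', (cayleyGraph S).Adj i j) → j ∈ D) → #A' ≤ 2 * N * #D := by
    intro A' hA' D hD
    refine card_le_two_mul_mul_card_boundary hconn hD (U := ball 1 N)
      (fun g hg => (hball _ _ _).1 hg) ?_
    rw [hvol]
    exact (Nat.mul_le_mul_left 2 (card_le_card hA')).trans hN
  have hrayleigh : 8 * N * (#E * (2 * growthFunction S (2 * r))) ≤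
      ε * (#Ω * (growthFunction S r * (r : ℝ) ^ 2)) := by
    have h1 : (growthFunction S (2 * r) : ℝ) ≤ C * 2 ^ d * C * growthFunction S r := by
      have h2 := (hg (2 * r) (by omega)).2
      have h3 := (hg r hr).1
      rw [inv_mul_le_iff₀ hC0] at h3
      calc (growthFunction S (2 * r) : ℝ) ≤ C * ((2 * r : ℕ) : ℝ) ^ d := h2
        _ = C * 2 ^ d * (r : ℝ) ^ d := by push_cast; ring
        _ ≤ C * 2 ^ d * (C * growthFunction S r) := by gcongr
        _ = _ := by ring
    have h4 : 32 * M * #S * (C * 2 ^ d * C) ≤ ε * r := by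
      rw [div_le_iff₀ hε] at hR
      have : (R : ℝ) ≤ r := by exact_mod_cast hRr
      nlinarith
    have h5 : (N : ℝ) ≤ 2 * M * r := by exact_mod_cast hNr
    calc 8 * N * (#E * (2 * growthFunction S (2 * r)) : ℝ)
        ≤ 8 * (2 * M * r) * (#Ω * #S * (2 * (C * 2 ^ d * C * growthFunction S r))) := by gcongr
      _ = 32 * M * #S * (C * 2 ^ d * C) * (#Ω * growthFunction S r * r) := by ring
      _ ≤ ε * r * (#Ω * growthFunction S r * r) := by gcongr
      _ = _ := by ring
  obtain ⟨T, hTcard, hTsep, hT⟩ := exists_separated_tents hconn hball hvol hEadj (B := B) hr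
    (ha₀.trans_le hcard)
    (fun T hT => card_le_card_boundary_far hconn hball hvol
      (fun j hj hi => (hB j).2 ⟨hj, hi⟩) hiso hr hT hK hKN) hrayleigh
  rw [Set.ncard_eq_toFinset_card _ hBfin]
  exact steklovEigenvalue_mem_Icc_of_tents hconn hΩ hB hE hTcard hTsep
    (fun x hx => (hT x hx).1) fun x hx => (hT x hx).2

end Cayley

end Steklov

theorem mainTheorem2 {G : Type*} [Group G] (S : Finset G)
    (hS_symm : ∀ s ∈ S, s⁻¹ ∈ S) (hS_one : (1 : G) ∉ S)
    (hS_gen : Subgroup.closure (S : Set G) = ⊤)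
    (d : ℕ) (hd : 2 ≤ d) (hgrowth : Steklov.HasPolynomialGrowth S d)
    (Ω : ℕ → Finset G)
    (hΩ_conn : ∀ l, ((Steklov.cayleyGraph S).induce (Ω l : Set G)).Connected)
    (hΩ_card : Filter.Tendsto (fun l => (Ω l).card) Filter.atTop Filter.atTop)
    (k : ℕ) :
    (∀ᶠ l in Filter.atTop,
      k < (Steklov.vertexBoundary (Steklov.cayleyGraph S) (Ω l : Set G)).ncard) ∧
    Filter.Tendsto (fun l => Steklov.subgraphSteklovEigenvalue S (Ω l) k)
      Filter.atTop (nhds 0) := by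
  have key : ∀ ε : ℝ, 0 < ε → ∀ᶠ l in Filter.atTop,
      k < (Steklov.vertexBoundary (Steklov.cayleyGraph S) (Ω l : Set G)).ncard ∧
        Steklov.subgraphSteklovEigenvalue S (Ω l) k ∈ Set.Icc 0 ε := by
    intro ε hε
    obtain ⟨a₀, ha₀⟩ := Steklov.exists_card_steklovEigenvalue_le hS_symm hS_one hS_gen hd
      hgrowth k hε
    filter_upwards [hΩ_card.eventually_ge_atTop a₀] with l hl
    exact ha₀ (Ω l) (hΩ_conn l) hl
  refine ⟨(key 1 one_pos).mono fun l hl => hl.1, ?_⟩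
  rw [Metric.tendsto_nhds]
  intro ε hε
  filter_upwards [key (ε / 2) (half_pos hε)] with l hl
  rw [Real.dist_eq, sub_zero, abs_of_nonneg hl.2.1]
  linarith [hl.2.2]
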